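/- A \emph{0-1-tree} is a nonempty binary plane tree on unlabeled vertices (every vertex has at most two children, and every child is a left child or a right child, even if it is the only child of its parent) in which every vertex with two children is labeled $0$ or $1$. For positive integers $n$ and $k$, let $\mathrm{BoNa}(n,k)$ be the number of 0-1-trees on $n$ vertices that have exactly $k-1$ right edges (edges from a vertex to its right child), and let $$\mathrm{BoNa}_n(u)=\sum_{k=1}^n \mathrm{BoNa}(n,k)\,u^k$$ be the Boolean-Narayana polynomial. Let $N_n(x)=\sum_{j=1}^n\binom nj\binom n{j-1}x^j$ be the ($n$-fold multiple of the) Narayana polynomial. For real $u<0$ put $$r_1(u)=\frac{-(1+u)+\sqrt{u^2-6u+1}}2,\qquad r_2(u)=\frac{-(1+u)-\sqrt{u^2-6u+1}}2,\qquad q(u)=\frac{r_1(u)}{r_2(u)},$$ so that $1+(1+u)y+2uy^2=(1-r_1(u)y)(1-r_2(u)y)$. Then the following hold. (a) For every positive integer $n$, all complex roots of the polynomial $\mathrm{BoNa}_n(u)$ are real. (b) For every positive integer $n$ and every real $u<0$, $$\mathrm{BoNa}_n(u)=u\,(-1)^{n-1}\,r_2(u)^{n-1}\,\frac{N_n(q(u))}{n\,q(u)}.$$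 (c) The function $q$ is strictly increasing on $(-\infty,0)$ and is a bijection of $(-\infty,0)$ onto itself. -/

import Mathlib

open Polynomial

/-- A (nonempty) 0-1-tree: a binary plane tree on unlabeled vertices, in which every child is a
left child or a right child even if it is an only child, and in which every vertex that has two
children carries a label 0 or 1. The constructors describe the root: no child, a left child only,
a right child only, or two children together with a label. -/
inductive ZeroOneTree : Type where
  | leaf : ZeroOneTree
  | leftOnly (l : ZeroOneTree) : ZeroOneTree
  | rightOnly (r : ZeroOneTree) : ZeroOneTree
  | both (label : Fin 2) (l r : ZeroOneTree) : ZeroOneTree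

namespace ZeroOneTree

/-- The number of vertices. -/
def numVertices : ZeroOneTree → ℕ
  | leaf => 1
  | leftOnly l => l.numVertices + 1
  | rightOnly r => r.numVertices + 1
  | both _ l r => l.numVertices + r.numVertices + 1

/-- The number of right edges, that is, of edges from a vertex to its right child. -/
def numRightEdges : ZeroOneTree → ℕ
  | leaf => 0
  | leftOnly l => l.numRightEdges
  | rightOnly r => r.numRightEdges + 1
  | both _ l r => l.numRightEdges + r.numRightEdges + 1

theorem finite_numVertices_le (n : ℕ) : {t : ZeroOneTree | t.numVertices ≤ n}.Finite := by
  induction n with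
  | zero =>
    refine Set.Finite.subset Set.finite_empty ?_
    rintro (_ | l | r | ⟨b, l, r⟩) h <;> simp [numVertices] at h
  | succ n ih =>
    have h2 : ((fun p : Fin 2 × ZeroOneTree × ZeroOneTree => both p.1 p.2.1 p.2.2) ''
        (Set.univ ×ˢ ({t : ZeroOneTree | t.numVertices ≤ n} ×ˢ
          {t : ZeroOneTree | t.numVertices ≤ n}))).Finite :=
      (Set.finite_univ.prod (ih.prod ih)).image _
    refine Set.Finite.subset ((((Set.finite_singleton leaf).union (ih.image leftOnly)).union
      (ih.image rightOnly)).union h2) ?_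
    rintro (_ | l | r | ⟨b, l, r⟩) h
    · simp
    · simpa [numVertices] using h
    · simpa [numVertices] using h
    · simp only [Set.mem_ofPred_eq, numVertices] at h
      refine Or.inr ⟨(b, l, r), ⟨trivial, ?_, ?_⟩, rfl⟩
      · simp only [Set.mem_ofPred_eq]; omega
      · simp only [Set.mem_ofPred_eq]; omega

end ZeroOneTree

/-- The set of 0-1-trees on `n` vertices that have `k - 1` right edges. -/
def boNaTrees (n k : ℕ) : Set ZeroOneTree :=
  {t | t.numVertices = n ∧ t.numRightEdges + 1 = k}

theorem boNaTrees_finite (n k : ℕ) : (boNaTrees n k).Finite :=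
  (ZeroOneTree.finite_numVertices_le n).subset fun _ h => h.1.le

/-- The Boolean-Narayana number `BoNa(n, k)`: the number of 0-1-trees on `n` vertices that have
`k - 1` right edges. -/
noncomputable def boNa (n k : ℕ) : ℕ := (boNaTrees n k).ncard

/-- The Boolean-Narayana polynomial `∑_{k=1}^n BoNa(n, k) u^k`. -/
noncomputable def boNaPoly (n : ℕ) : ℝ[X] :=
  ∑ k ∈ Finset.Icc 1 n, C (boNa n k : ℝ) * X ^ k

/-- The Narayana polynomial, in the normalization `∑_{j=1}^n (n choose j) (n choose (j-1)) x^j`. -/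
noncomputable def narayanaPoly (n : ℕ) : ℝ[X] :=
  ∑ j ∈ Finset.Icc 1 n, C ((n.choose j : ℝ) * (n.choose (j - 1) : ℝ)) * X ^ j

/-- `r₁(u)`, where `1 + (1 + u) y + 2 u y ^ 2 = (1 - r₁ y) (1 - r₂ y)`; used for `u < 0`. -/
noncomputable def rOne (u : ℝ) : ℝ := (-(1 + u) + √(u ^ 2 - 6 * u + 1)) / 2

/-- `r₂(u)`, where `1 + (1 + u) y + 2 u y ^ 2 = (1 - r₁ y) (1 - r₂ y)`; used for `u < 0`. -/
noncomputable def rTwo (u : ℝ) : ℝ := (-(1 + u) - √(u ^ 2 - 6 * u + 1)) / 2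

theorem rOne_rTwo_factor {u : ℝ} (hu : u < 0) (y : ℝ) :
    1 + (1 + u) * y + 2 * u * y ^ 2 = (1 - rOne u * y) * (1 - rTwo u * y) := by
  have h : √(u ^ 2 - 6 * u + 1) ^ 2 = u ^ 2 - 6 * u + 1 := Real.sq_sqrt (by nlinarith)
  unfold rOne rTwo
  linear_combination (y ^ 2 / 4) * h

/-- `q(u) = r₁(u) / r₂(u)`. -/
noncomputable def qFun (u : ℝ) : ℝ := rOne u / rTwo u

/-! Splitting a tree at its root shows that the series `B` of `weight u n` satisfies `B = X φ(B)`
with `φ(y) = 1 + (1 + u) y + 2 u y ^ 2`. Write `φ = (1 + a y)(1 + b y)`; Lagrange inversion then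
gives `n * weight u n = narayanaForm (n - 1) a b`, a homogeneous Narayana polynomial
(`succ_mul_weight_succ`). For `u < 0`, taking `a = -r₁`, `b = -r₂` and using homogeneity yields (b).
For (a), take `u` complex. At `(w, w + 1)` the form is, up to the factor `w (w + 1)`, a Hasse
derivative of a real-rooted polynomial, so its zeros `w` are real by Rolle. A zero `(a, b)` with `a
≠ b` rescales to such a pair, and a real ratio forces a real `u`. This bypasses (b) and (c). Part
(c) is a direct computation. -/

/-! ### The function `q`. -/

theorem rOne_mul_rTwo {u : ℝ} (hu : u < 0) : rOne u * rTwo u = 2 * u := by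
  have h : √(u ^ 2 - 6 * u + 1) ^ 2 = u ^ 2 - 6 * u + 1 := Real.sq_sqrt (by nlinarith)
  unfold rOne rTwo
  linear_combination (-1 / 4) * h

theorem rOne_add_rTwo (u : ℝ) : rOne u + rTwo u = -(1 + u) := by
  unfold rOne rTwo
  ring

theorem rTwo_neg {u : ℝ} (hu : u < 0) : rTwo u < 0 := by
  have h := rOne_mul_rTwo hu
  have h0 : 0 ≤ √(u ^ 2 - 6 * u + 1) := Real.sqrt_nonneg _
  have h1 : rTwo u ≤ rOne u := by unfold rOne rTwo; linarith
  by_contra! h2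
  nlinarith [mul_nonneg (h2.trans h1) h2]

theorem rOne_pos {u : ℝ} (hu : u < 0) : 0 < rOne u := by
  by_contra! h
  nlinarith [mul_nonneg_of_nonpos_of_nonpos h (rTwo_neg hu).le, rOne_mul_rTwo hu]

theorem qFun_neg {u : ℝ} (hu : u < 0) : qFun u < 0 :=
  div_neg_of_pos_of_neg (rOne_pos hu) (rTwo_neg hu)

/-- Cleared of denominators, this is the monotonicity of `(1 + u) / √(u ^ 2 - 6 u + 1)`, which is
equivalent to that of `q`. Squares are compared, split by the signs of `1 + u` and `1 + v`. -/
theorem one_add_mul_sqrt_lt {u v : ℝ} (hv : v < 0) (huv : u < v) :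
    (1 + u) * √(v ^ 2 - 6 * v + 1) < (1 + v) * √(u ^ 2 - 6 * u + 1) := by
  have hu := huv.trans hv
  have hp : 0 < √(u ^ 2 - 6 * u + 1) := Real.sqrt_pos.2 (by nlinarith)
  have hq : 0 < √(v ^ 2 - 6 * v + 1) := Real.sqrt_pos.2 (by nlinarith)
  have hp2 : √(u ^ 2 - 6 * u + 1) ^ 2 = u ^ 2 - 6 * u + 1 := Real.sq_sqrt (by nlinarith)
  have hq2 : √(v ^ 2 - 6 * v + 1) ^ 2 = v ^ 2 - 6 * v + 1 := Real.sq_sqrt (by nlinarith)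
  set p := √(u ^ 2 - 6 * u + 1)
  set q := √(v ^ 2 - 6 * v + 1)
  have key : ((1 + v) * p) ^ 2 - ((1 + u) * q) ^ 2 = 8 * ((v - u) * (1 - u * v)) := by
    rw [mul_pow, mul_pow, hp2, hq2]; ring
  rcases lt_or_ge 0 (1 + u) with hs | hs
  · have : 0 < (v - u) * (1 - u * v) := mul_pos (by linarith) (by nlinarith)
    refine lt_of_pow_lt_pow_left₀ 2 (mul_nonneg (by linarith) hp.le) (by linarith)
  · rcases le_or_gt 0 (1 + v) with ht | ht
    · rcases hs.lt_or_eq with hs' | hs'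
      · exact (mul_neg_of_neg_of_pos hs' hq).trans_le (mul_nonneg ht hp.le)
      · rw [hs', zero_mul]
        exact mul_pos (by linarith) hp
    · have : (v - u) * (1 - u * v) < 0 := mul_neg_of_pos_of_neg (by linarith) (by nlinarith)
      have := lt_of_pow_lt_pow_left₀ 2 (a := -(1 + v) * p) (b := -(1 + u) * q)
        (mul_nonneg (by linarith) hq.le) (by nlinarith)
      linarith

theorem qFun_strictMonoOn : StrictMonoOn qFun (Set.Iio 0) := by
  intro u hu v hv huv
  have h := one_add_mul_sqrt_lt hv huv
  unfold qFun
  rw [← sub_pos, div_sub_div _ _ (rTwo_neg hv).ne (rTwo_neg hu).ne]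
  refine div_pos ?_ (mul_pos_of_neg_of_neg (rTwo_neg hv) (rTwo_neg hu))
  unfold rOne rTwo
  linarith

theorem qFun_surjOn : Set.SurjOn qFun (Set.Iio 0) (Set.Iio 0) := by
  intro y hy
  have hy : y < 0 := hy
  have hk2 : √(1 + y ^ 2) ^ 2 = 1 + y ^ 2 := Real.sq_sqrt (by positivity)
  have hy0 : y ≠ 0 := hy.ne
  have hk1 : 1 ≤ √(1 + y ^ 2) := Real.one_le_sqrt.2 (by nlinarith)
  set k := √(1 + y ^ 2)
  have hc : 1 + y - k < 0 := by linarith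
  have hu : (1 + y - k) ^ 2 / (2 * y) < 0 :=
    div_neg_of_pos_of_neg (sq_pos_of_neg hc) (by linarith)
  -- Putting `r₁ = y r₂` into the sum and product of the roots gives `y r₂ ^ 2 + 2 (1 + y) r₂ + 2 =
  -- 0`; its negative solution is `r₂ = -(1 + y - k) / y`, and `u = y r₂ ^ 2 / 2`.
  refine ⟨(1 + y - k) ^ 2 / (2 * y), hu, ?_⟩
  have hadd : 1 + (1 + y - k) ^ 2 / (2 * y) = (1 + y) * (1 + y - k) / y := by
    field_simp
    linear_combination hk2
  have hsqrt : √(((1 + y - k) ^ 2 / (2 * y)) ^ 2 - 6 * ((1 + y - k) ^ 2 / (2 * y)) + 1) =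
      (1 - y) * (1 + y - k) / y := by
    rw [Real.sqrt_eq_iff_mul_self_eq (by nlinarith)
      (div_nonneg_of_nonpos (mul_nonpos_of_nonneg_of_nonpos (by linarith) hc.le) hy.le)]
    have e : ((1 + y - k) ^ 2 / (2 * y)) ^ 2 - 6 * ((1 + y - k) ^ 2 / (2 * y)) + 1 =
      (1 + (1 + y - k) ^ 2 / (2 * y)) ^ 2 - 8 * ((1 + y - k) ^ 2 / (2 * y)) := by ring
    rw [e, hadd]
    field_simp
    ring
  unfold qFun rOne rTwo
  rw [hsqrt, hadd, div_eq_iff]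
  · field_simp
    ring
  · have : (-((1 + y) * (1 + y - k) / y) - (1 - y) * (1 + y - k) / y) / 2 = -((1 + y - k) / y) := by
      ring
    rw [this]
    exact neg_ne_zero.2 (div_ne_zero hc.ne hy.ne)

theorem qFun_bijOn : Set.BijOn qFun (Set.Iio 0) (Set.Iio 0) :=
  ⟨fun _ hu => qFun_neg hu, qFun_strictMonoOn.injOn, qFun_surjOn⟩

/-! ### Lagrange inversion for a quadratic. -/

-- Induction on `n` for all `k` at once: the equation for `B` expresses `B ^ (k + 1)` through `X`
-- times powers of `B`, to which the hypothesis at `n` applies.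
open PowerSeries in
theorem PowerSeries.natCast_mul_coeff_pow_of_eq_X_mul_quadratic {K : Type*} [Field K] [CharZero K]
    {s p : K} {B : K⟦X⟧} (hB : B = X * (1 + C s * B + C p * B ^ 2)) {n : ℕ} (hn : 0 < n) (k : ℕ) :
    (n : K) * coeff n (B ^ k) = k * coeff n (X ^ k * (1 + C s * X + C p * X ^ 2) ^ n) := by
  have hB0 : constantCoeff B = 0 := by rw [hB]; simp
  induction n, hn using Nat.le_induction generalizing k with
  | base =>
    rcases k with _ | _ | k
    · simp [coeff_one]
    · rw [zero_add, pow_one, pow_one, pow_one, hB, show (1 : ℕ) = 0 + 1 from rfl,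
        coeff_succ_X_mul, coeff_succ_X_mul]
      simp [hB0]
    · rw [hB, mul_pow, pow_add X k 2, mul_comm (X ^ k) (X ^ 2), mul_assoc, mul_assoc, 
        coeff_X_pow_mul']
      simp only [Nat.cast_add, Nat.cast_one, Nat.succ_eq_add_one, zero_add,
        show ¬ 2 ≤ 1 by lia, if_false, mul_zero, zero_eq_mul]
      exact Or.inr (by rw [PowerSeries.coeff_X_pow_mul']; simp)
  | succ n hn ih =>
    rcases k with _ | k
    · simp [coeff_one]
    have hn0 : (n : K) ≠ 0 := by exact_mod_cast (by lia : n ≠ 0)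
    set φ : K⟦X⟧ := 1 + C s * X + C p * X ^ 2 with hφ
    have e1 : B ^ (k + 1) = X * (B ^ k + C s * B ^ (k + 1) + C p * B ^ (k + 2)) := by
      rw [pow_succ, pow_succ, pow_add]
      nth_rewrite 2 [hB]
      ring
    have e2 : (n : K) * coeff (n + 1) (B ^ (k + 1)) =
        coeff n (C (k : K) * (X ^ k * φ ^ (n + 1)) +
          X ^ k * φ ^ n * (C s * X + 2 * C p * X ^ 2)) := by
      rw [e1, coeff_succ_X_mul, map_add, map_add, coeff_C_mul, coeff_C_mul, mul_add, mul_add,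
        mul_left_comm _ s, mul_left_comm _ p, ih, ih, ih, ← coeff_C_mul, ← coeff_C_mul,
        ← coeff_C_mul, ← coeff_C_mul, ← coeff_C_mul, ← map_add, ← map_add]
      congr 1
      push_cast
      simp only [map_add, map_natCast, map_one, map_ofNat]
      rw [pow_succ φ n]
      nth_rewrite 5 [hφ]
      ring
    have hd : d⁄dX K φ = (C s + 2 * C p * X : K⟦X⟧) := by
      simp [hφ, Derivation.leibniz, pow_two]
      ring
    -- The Euler operator `X d/dX` multiplies the `n`-th coefficient by `n`; the product rule in
    -- `e4` then eliminates the `X φ'` term of `e2`.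
    have e3 : coeff n (X * d⁄dX K (X ^ k * φ ^ (n + 1)) : K⟦X⟧) =
        n * coeff n (X ^ k * φ ^ (n + 1)) := by
      obtain ⟨m, rfl⟩ := Nat.exists_eq_add_of_le' hn
      rw [coeff_succ_X_mul, coeff_derivative]
      push_cast; ring
    have e4 : (X * d⁄dX K (X ^ k * φ ^ (n + 1)) : K⟦X⟧) = C (k : K) * (X ^ k * φ ^ (n + 1)) +
        C ((n + 1 : ℕ) : K) * (X ^ k * φ ^ n * (C s * X + 2 * C p * X ^ 2)) := by
      rw [Derivation.leibniz, Derivation.leibniz_pow, Derivation.leibniz_pow, hd]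
      rcases k with _ | k
      · simp [smul_eq_mul, nsmul_eq_mul]
        ring
      · simp [smul_eq_mul, nsmul_eq_mul]
        ring
    rw [e4, map_add, coeff_C_mul, coeff_C_mul] at e3
    rw [map_add, coeff_C_mul] at e2
    have e5 : coeff (n + 1) (X ^ (k + 1) * φ ^ (n + 1)) = coeff n (X ^ k * φ ^ (n + 1)) := by
      rw [pow_succ', mul_assoc, coeff_succ_X_mul]
    rw [e5]
    apply mul_left_cancel₀ hn0
    push_cast at e3 ⊢
    linear_combination (n + 1 : K) * e2 + e3

/-! ### Real-rootedness of the Narayana form. -/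

theorem coeff_add_C_pow_mul_pow {K : Type*} [CommRing K] (m : ℕ) (a b : K) :
    ((X + C a) ^ (m + 1) * (X + C b) ^ (m + 1)).coeff m =
      a * b * ∑ ij ∈ Finset.HasAntidiagonal.antidiagonal m,
        ((m + 1).choose ij.1 : K) * ((m + 1).choose ij.2 : K) * (a ^ ij.1 * b ^ ij.2) := by
  rw [coeff_mul, ← Finset.Nat.sum_antidiagonal_swap, Finset.mul_sum]
  refine Finset.sum_congr rfl fun ij hij => ?_
  obtain ⟨i, j⟩ := ij
  rw [Finset.HasAntidiagonal.mem_antidiagonal] at hij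
  simp only [Prod.swap, coeff_X_add_C_pow] at hij ⊢
  rw [show m + 1 - j = i + 1 by lia, show m + 1 - i = j + 1 by lia]
  ring

theorem powerSeries_coeff_one_add_C_mul_X_pow {K : Type*} [CommRing K] (a : K) (n i : ℕ) :
    PowerSeries.coeff i ((1 + PowerSeries.C a * PowerSeries.X : PowerSeries K) ^ n) =
      n.choose i * a ^ i := by
  have h : ((1 + PowerSeries.C a * PowerSeries.X : PowerSeries K) ^ n) =
      (((1 + C a * X : K[X]) ^ n : K[X]) : PowerSeries K) := by
    push_cast
    rfl
  rw [h, Polynomial.coeff_coe, add_comm, add_pow, finsetSum_coeff]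
  simp only [one_pow, mul_one, mul_pow, ← C_pow, ← C_eq_natCast, coeff_mul_C, coeff_C_mul,
    coeff_X_pow, mul_ite, mul_zero, ite_mul, zero_mul, Finset.sum_ite_eq, Finset.mem_range]
  split_ifs with hi
  · ring
  · rw [Nat.choose_eq_zero_of_lt (by lia)]
    simp

/-- By Rolle, differentiation loses at most one root, and the degree drops too. -/
theorem Polynomial.Splits.derivative_of_real {p : ℝ[X]} (h : p.Splits) : (derivative p).Splits := by
  rcases Nat.eq_zero_or_pos p.natDegree with h0 | h0
  · rw [natDegree_eq_zero] at h0
    obtain ⟨c, rfl⟩ := h0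
    simp
  rw [splits_iff_card_roots] at h ⊢
  have h1 := card_roots_le_derivative p
  have h2 := card_roots' (derivative p)
  have h3 := natDegree_derivative_le p
  lia

theorem Polynomial.Splits.hasseDeriv_of_real {p : ℝ[X]} (h : p.Splits) (m : ℕ) :
    (hasseDeriv m p).Splits := by
  have h1 : ((derivative)^[m] p).Splits := by
    induction m with
    | zero => simpa
    | succ m ih =>
      rw [Function.iterate_succ_apply']
      exact ih.derivative_of_real
  have h2 : hasseDeriv m p = C ((m.factorial : ℝ)⁻¹) * (derivative)^[m] p := by
    rw [← factorial_smul_hasseDeriv, LinearMap.smul_apply, nsmul_eq_mul, ← C_eq_natCast,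
      ← mul_assoc, ← C_mul, inv_mul_cancel₀ (by positivity), C_1, one_mul]
  rw [h2]
  exact (Splits.C _).mul h1

/-- The two-variable homogeneous form of the Narayana polynomial of index `m + 1`. -/
def narayanaForm {K : Type*} [CommRing K] (m : ℕ) (a b : K) : K :=
  ∑ ij ∈ Finset.HasAntidiagonal.antidiagonal m,
    ((m + 1).choose ij.1 : K) * ((m + 1).choose ij.2 : K) * (a ^ ij.1 * b ^ ij.2)

/-- The Hasse derivative at `w` is a Taylor coefficient, here that of `X ^ m` in `(X + w) ^ (m + 1)
* (X + w + 1) ^ (m + 1)`. -/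
theorem eval_hasseDeriv_X_pow_mul_X_add_one_pow {K : Type*} [CommRing K] (m : ℕ) (w : K) :
    (hasseDeriv m (X ^ (m + 1) * (X + 1) ^ (m + 1) : K[X])).eval w =
      w * (w + 1) * narayanaForm m w (w + 1) := by
  rw [← taylor_coeff, narayanaForm, ← coeff_add_C_pow_mul_pow]
  congr 1
  simp [taylor_apply, add_assoc]

theorem narayanaForm_mul {K : Type*} [CommRing K] (m : ℕ) (a b d : K) :
    narayanaForm m (a * d) (b * d) = d ^ m * narayanaForm m a b := by
  rw [narayanaForm, narayanaForm, Finset.mul_sum]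
  refine Finset.sum_congr rfl fun ij hij => ?_
  rw [Finset.HasAntidiagonal.mem_antidiagonal] at hij
  rw [← hij]
  ring

theorem narayanaForm_self_ne_zero {K : Type*} [Field K] [CharZero K] (m : ℕ) {a : K} (ha : a ≠ 0) :
    narayanaForm m a a ≠ 0 := by
  have h1 := narayanaForm_mul m 1 1 a
  rw [one_mul] at h1
  rw [h1]
  refine mul_ne_zero (pow_ne_zero _ ha) ?_
  have h2 : narayanaForm m (1 : K) 1 = ((∑ ij ∈ Finset.HasAntidiagonal.antidiagonal m,
      (m + 1).choose ij.1 * (m + 1).choose ij.2 : ℕ) : K) := by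
    simp [narayanaForm]
  rw [h2, Nat.cast_ne_zero, ← Nat.add_choose_eq]
  exact (Nat.choose_pos (by lia)).ne'

theorem exists_real_eq_of_narayanaForm_add_one_eq_zero {m : ℕ} {w : ℂ} (hw : narayanaForm m w (w + 1) = 0) :
    ∃ x : ℝ, w = x := by
  have hs : (hasseDeriv m (X ^ (m + 1) * (X + 1) ^ (m + 1) : ℝ[X])).Splits := by
    refine Splits.hasseDeriv_of_real ?_ m
    exact (Splits.X.pow _).mul ((Splits.X_add_C 1).pow _)
  have h0 : hasseDeriv m (X ^ (m + 1) * (X + 1) ^ (m + 1) : ℝ[X]) ≠ 0 := by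
    intro h
    have h1 := eval_hasseDeriv_X_pow_mul_X_add_one_pow m (1 : ℝ)
    rw [h, eval_zero] at h1
    have h2 : 0 < narayanaForm m (1 : ℝ) (1 + 1) := by
      refine Finset.sum_pos (fun ij hij => ?_) ⟨(0, m), by simp⟩
      rw [Finset.HasAntidiagonal.mem_antidiagonal] at hij
      have h3 := Nat.choose_pos (n := m + 1) (k := ij.1) (by lia)
      have h4 := Nat.choose_pos (n := m + 1) (k := ij.2) (by lia)
      positivity
    linarith
  have hr : (map Complex.ofRealHom (hasseDeriv m (X ^ (m + 1) * (X + 1) ^ (m + 1) : ℝ[X]))).IsRoot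
      w := by
    have h1 := eval_hasseDeriv_X_pow_mul_X_add_one_pow m w
    rw [hw, mul_zero, ← taylor_coeff] at h1
    rw [IsRoot, ← h1, taylor_coeff]
    congr 1
    ext i
    rw [coeff_map, hasseDeriv_coeff, hasseDeriv_coeff]
    have h2 : (X ^ (m + 1) * (X + 1) ^ (m + 1) : ℂ[X]) =
        map Complex.ofRealHom (X ^ (m + 1) * (X + 1) ^ (m + 1)) := by simp
    rw [h2, coeff_map, map_mul, map_natCast]
  obtain ⟨x, hx⟩ := hs.mem_range_of_isRoot h0 hr
  exact ⟨x, hx.symm⟩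

theorem exists_real_eq_of_narayanaForm_eq_zero {m : ℕ} {z a b : ℂ} (hadd : a + b = 1 + z)
    (hmul : a * b = 2 * z) (h : narayanaForm m a b = 0) : ∃ x : ℝ, z = x := by
  -- On the diagonal the form is a positive integer (Vandermonde) times `a ^ m`, so only `a = b = 0`
  -- can vanish.
  by_cases hab : b - a = 0
  · obtain rfl : b = a := sub_eq_zero.1 hab
    have hb : b = 0 := by
      by_contra hb
      exact narayanaForm_self_ne_zero m hb h
    subst hb
    exact ⟨0, by simpa using hmul⟩
  set d := b - a with hd
  have hw1 : a / d + 1 = b / d := by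
    field_simp
    rw [hd]; ring
  have hw : narayanaForm m (a / d) (a / d + 1) = 0 := by
    rw [hw1, div_eq_mul_inv, div_eq_mul_inv, narayanaForm_mul, h, mul_zero]
  obtain ⟨w, hw2⟩ := exists_real_eq_of_narayanaForm_add_one_eq_zero hw
  have ha : a = w * d := by rw [← hw2, div_mul_cancel₀ _ hab]
  have hb : b = (w + 1) * d := by rw [← hw2, hw1, div_mul_cancel₀ _ hab]
  by_cases hm : w * (w + 1) = 0
  · refine ⟨0, ?_⟩
    have hm' : (w : ℂ) * (w + 1) = 0 := by exact_mod_cast hm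
    rw [ha, hb] at hmul
    push_cast
    linear_combination (-1 / 2) * hmul + d ^ 2 / 2 * hm'
  · have hm' : (w : ℂ) * (w + 1) ≠ 0 := by exact_mod_cast hm
    -- Eliminating `d` from `(2w + 1) d = 1 + z` and `w (w + 1) d ^ 2 = 2 z` leaves a real quadratic
    -- in `z`; completing the square shows a nonnegative discriminant.
    have hsq : (w * (w + 1) * z - (3 * (w * (w + 1)) + 1)) ^ 2 =
        (((2 * w + 1) * √(w ^ 2 + (w + 1) ^ 2) : ℝ) : ℂ) ^ 2 := by
      have h1 : √(w ^ 2 + (w + 1) ^ 2) ^ 2 = w ^ 2 + (w + 1) ^ 2 := Real.sq_sqrt (by positivity)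
      rw [← Complex.ofReal_pow, mul_pow, h1]
      rw [ha, hb] at hadd hmul
      push_cast
      linear_combination ((w : ℂ) * (w + 1)) * (2 * w + 1) ^ 2 * hmul -
        ((w : ℂ) * (w + 1)) ^ 2 * (1 + z + (2 * w + 1) * d) * hadd
    rcases sq_eq_sq_iff_eq_or_eq_neg.1 hsq with h1 | h1
    · refine ⟨((2 * w + 1) * √(w ^ 2 + (w + 1) ^ 2) + (3 * (w * (w + 1)) + 1)) / (w * (w + 1)), ?_⟩
      push_cast at h1 ⊢
      rw [eq_div_iff hm']
      linear_combination h1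
    · refine ⟨(-((2 * w + 1) * √(w ^ 2 + (w + 1) ^ 2)) + (3 * (w * (w + 1)) + 1)) / (w * (w + 1)),
        ?_⟩
      push_cast at h1 ⊢
      rw [eq_div_iff hm']
      linear_combination h1

/-! ### Root decomposition of 0-1-trees. -/

namespace ZeroOneTree

theorem numVertices_pos (t : ZeroOneTree) : 0 < t.numVertices := by
  cases t <;> simp [numVertices]

theorem numRightEdges_lt_numVertices (t : ZeroOneTree) : t.numRightEdges < t.numVertices := by
  induction t <;> simp only [numVertices, numRightEdges] <;> lia

/-- The finite set of 0-1-trees on `n` vertices. -/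
noncomputable def withVertices (n : ℕ) : Finset ZeroOneTree :=
  ((finite_numVertices_le n).subset (t := {t | t.numVertices = n}) fun _ h => le_of_eq h).toFinset

theorem mem_withVertices {n : ℕ} {t : ZeroOneTree} : t ∈ withVertices n ↔ t.numVertices = n := by
  simp [withVertices]

theorem withVertices_zero : withVertices 0 = ∅ := by
  ext t
  simpa [mem_withVertices] using t.numVertices_pos.ne'

open Classical in
theorem withVertices_succ (n : ℕ) : withVertices (n + 1) =
    (((if n = 0 then {leaf} else ∅) ∪ (withVertices n).image leftOnly) ∪
      (withVertices n).image rightOnly) ∪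
      (Finset.univ ×ˢ (Finset.HasAntidiagonal.antidiagonal n).sigma
        fun ij => withVertices ij.1 ×ˢ withVertices ij.2).image
        fun x : Fin 2 × (Σ _ : ℕ × ℕ, ZeroOneTree × ZeroOneTree) => both x.1 x.2.2.1 x.2.2.2 := by
  ext t
  rw [mem_withVertices]
  simp only [Finset.mem_union, Finset.mem_image, Finset.mem_product, Finset.mem_sigma,
    mem_withVertices, Finset.mem_univ, true_and, Finset.HasAntidiagonal.mem_antidiagonal]
  rcases t with _ | l | r | ⟨c, l, r⟩
  · by_cases hn : n = 0 <;> simp [numVertices, hn]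
  · by_cases hn : n = 0 <;> simp [numVertices, hn]
  · by_cases hn : n = 0 <;> simp [numVertices, hn]
  · have : (if n = 0 then ({leaf} : Finset ZeroOneTree) else ∅) ⊆ {leaf} := by split <;> simp
    constructor
    · intro h
      simp only [numVertices] at h
      exact Or.inr ⟨(c, ⟨(l.numVertices, r.numVertices), (l, r)⟩), ⟨by lia, rfl, rfl⟩, rfl⟩
    · rintro (((h | ⟨_, _, h⟩) | ⟨_, _, h⟩) | ⟨⟨d, ⟨⟨i, j⟩, l', r'⟩⟩, ⟨h1, h2, h3⟩, h⟩)
      · simpa using this h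
      · cases h
      · cases h
      · cases h
        simp only at h1 h2 h3
        simp only [numVertices]
        lia

/-- The generating polynomial of the 0-1-trees on `n` vertices by their number of right edges. -/
noncomputable def weight {K : Type*} [CommRing K] (u : K) (n : ℕ) : K :=
  ∑ t ∈ withVertices n, u ^ t.numRightEdges

theorem weight_zero {K : Type*} [CommRing K] (u : K) : weight u 0 = 0 := by
  simp [weight, withVertices_zero]

/-- A lone left child contributes `1`, a lone right child `u`, and two children `2 u`, the `2`
counting labels. -/
theorem weight_succ {K : Type*} [CommRing K] (u : K) (n : ℕ) :
    weight u (n + 1) = (if n = 0 then 1 else 0) + (1 + u) * weight u n +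
      2 * u * ∑ ij ∈ Finset.HasAntidiagonal.antidiagonal n, weight u ij.1 * weight u ij.2 := by
  classical
  rw [weight, withVertices_succ, Finset.sum_union, Finset.sum_union, Finset.sum_union,
    Finset.sum_image, Finset.sum_image, Finset.sum_image, Finset.sum_product]
  · have h1 : ∑ t ∈ (if n = 0 then ({leaf} : Finset ZeroOneTree) else ∅), u ^ t.numRightEdges =
        if n = 0 then 1 else 0 := by
      split <;> simp [numRightEdges]
    have h2 : ∀ ij : ℕ × ℕ, ∑ x ∈ withVertices ij.1 ×ˢ withVertices ij.2,
        u ^ (x.1.numRightEdges + x.2.numRightEdges + 1) = u * (weight u ij.1 * weight u ij.2) := by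
      intro ij
      rw [weight, weight, Finset.sum_mul_sum, ← Finset.sum_product', Finset.mul_sum]
      refine Finset.sum_congr rfl fun x _ => ?_
      ring
    dsimp only
    rw [h1]
    simp only [Finset.sum_const, Finset.sum_sigma, numRightEdges, h2, pow_succ u (numRightEdges _), ← Finset.sum_mul, ← Finset.mul_sum]
    simp only [Finset.card_univ, Fintype.card_fin, weight]
    ring
  · rintro ⟨c, ⟨i, j⟩, l, r⟩ h ⟨c', ⟨i', j'⟩, l', r'⟩ h' e
    simp only [both.injEq] at e
    obtain ⟨rfl, rfl, rfl⟩ := e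
    simp only [Finset.coe_product, Set.mem_prod, Finset.mem_coe, Finset.mem_sigma,
      Finset.mem_product, mem_withVertices] at h h'
    obtain ⟨-, -, rfl, rfl⟩ := h
    obtain ⟨-, -, rfl, rfl⟩ := h'
    rfl
  · intro a _ b _ e
    cases e; rfl
  · intro a _ b _ e
    cases e; rfl
  · rw [Finset.disjoint_left]
    intro t h h'
    obtain ⟨_, _, rfl⟩ := Finset.mem_image.1 h'
    split at h <;> simp at h
  · rw [Finset.disjoint_left]
    intro t h h'
    obtain ⟨_, _, rfl⟩ := Finset.mem_image.1 h'
    split at h <;> simp at h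
  · rw [Finset.disjoint_left]
    intro t h h'
    obtain ⟨_, _, rfl⟩ := Finset.mem_image.1 h'
    split at h <;> simp at h

end ZeroOneTree

/-! ### From trees to the Narayana form. -/

theorem aeval_boNaPoly {K : Type*} [CommRing K] [Algebra ℝ K] (n : ℕ) (u : K) :
    aeval u (boNaPoly n) = u * ZeroOneTree.weight u n := by
  have h1 : ∀ k, boNa n k = ((ZeroOneTree.withVertices n).filter
      fun t => t.numRightEdges + 1 = k).card := by
    intro k
    rw [boNa, ← Set.ncard_coe_finset]
    congr 1
    ext t
    simp [boNaTrees, ZeroOneTree.mem_withVertices]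
  rw [boNaPoly, map_sum, ZeroOneTree.weight, Finset.mul_sum,
    ← Finset.sum_fiberwise_of_maps_to (t := Finset.Icc 1 n)
      (g := fun t : ZeroOneTree => t.numRightEdges + 1)]
  · refine Finset.sum_congr rfl fun k _ => ?_
    rw [h1, Finset.sum_congr rfl (g := fun _ => u ^ k)]
    · simp
    · intro t ht
      rw [← (Finset.mem_filter.1 ht).2]
      ring
  · intro t ht
    have h2 := t.numRightEdges_lt_numVertices
    rw [ZeroOneTree.mem_withVertices] at ht
    rw [Finset.mem_Icc]
    lia

theorem mk_weight_eq {K : Type*} [CommRing K] (u : K) :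
    PowerSeries.mk (ZeroOneTree.weight u) =
      PowerSeries.X * (1 + PowerSeries.C (1 + u) * PowerSeries.mk (ZeroOneTree.weight u) +
        PowerSeries.C (2 * u) * PowerSeries.mk (ZeroOneTree.weight u) ^ 2) := by
  ext n
  rcases n with _ | n
  · simp [ZeroOneTree.weight_zero]
  · rw [PowerSeries.coeff_succ_X_mul, map_add, map_add, PowerSeries.coeff_C_mul,
      PowerSeries.coeff_C_mul, PowerSeries.coeff_mk, PowerSeries.coeff_mk, pow_two,
      PowerSeries.coeff_mul, PowerSeries.coeff_one, ZeroOneTree.weight_succ]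
    simp only [PowerSeries.coeff_mk]

theorem succ_mul_weight_succ {K : Type*} [Field K] [CharZero K] {u a b : K} (hadd : a + b = 1 + u)
    (hmul : a * b = 2 * u) (m : ℕ) :
    ((m : K) + 1) * ZeroOneTree.weight u (m + 1) = narayanaForm m a b := by
  have h := PowerSeries.natCast_mul_coeff_pow_of_eq_X_mul_quadratic (mk_weight_eq u)
    m.succ_pos 1
  have e : (1 + PowerSeries.C (1 + u) * PowerSeries.X +
      PowerSeries.C (2 * u) * PowerSeries.X ^ 2 : PowerSeries K) =
      (1 + PowerSeries.C a * PowerSeries.X) * (1 + PowerSeries.C b * PowerSeries.X) := by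
    rw [← hadd, ← hmul, map_add, map_mul]
    ring
  rw [pow_one, pow_one, e, mul_pow, PowerSeries.coeff_mk, PowerSeries.coeff_succ_X_mul,
    PowerSeries.coeff_mul] at h
  rw [← Nat.cast_succ, h, Nat.cast_one, one_mul, narayanaForm]
  refine Finset.sum_congr rfl fun ij _ => ?_
  rw [powerSeries_coeff_one_add_C_mul_X_pow, powerSeries_coeff_one_add_C_mul_X_pow]
  ring

theorem eval_narayanaPoly (m : ℕ) (x : ℝ) :
    (narayanaPoly (m + 1)).eval x = x * narayanaForm m x 1 := by
  rw [narayanaPoly, eval_finsetSum, narayanaForm,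
    Finset.Nat.sum_antidiagonal_eq_sum_range_succ_mk, Finset.mul_sum,
    ← Finset.Ico_succ_right_eq_Icc, Finset.sum_Ico_eq_sum_range]
  refine Finset.sum_congr (by simp) fun i hi => ?_
  have hi : i ≤ m := by simpa [Nat.lt_succ_iff] using hi
  rw [eval_mul, eval_C, eval_pow, eval_X, Nat.add_sub_cancel_left,
    ← Nat.choose_symm (n := m + 1) (k := 1 + i) (by lia), show m + 1 - (1 + i) = m - i by lia]
  ring

theorem real_of_aeval_boNaPoly_eq_zero {n : ℕ} (hn : 0 < n) {z : ℂ}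
    (hz : aeval z (boNaPoly n) = 0) : ∃ x : ℝ, z = x := by
  obtain ⟨m, rfl⟩ := Nat.exists_eq_add_of_le' hn
  rw [aeval_boNaPoly, mul_eq_zero] at hz
  rcases hz with rfl | hz
  · exact ⟨0, by simp⟩
  obtain ⟨c, hc⟩ := IsAlgClosed.exists_pow_nat_eq ((1 + z) ^ 2 - 8 * z) (n := 2) two_pos
  have hadd : (1 + z + c) / 2 + (1 + z - c) / 2 = 1 + z := by ring
  have hmul : (1 + z + c) / 2 * ((1 + z - c) / 2) = 2 * z := by
    linear_combination (-1 / 4) * hc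
  refine exists_real_eq_of_narayanaForm_eq_zero (m := m) hadd hmul ?_
  rw [← succ_mul_weight_succ hadd hmul, hz, mul_zero]

theorem eval_boNaPoly {n : ℕ} (hn : 0 < n) {u : ℝ} (hu : u < 0) :
    (boNaPoly n).eval u =
      u * (-1) ^ (n - 1) * rTwo u ^ (n - 1) * ((narayanaPoly n).eval (qFun u) / (n * qFun u)) := by
  obtain ⟨m, rfl⟩ := Nat.exists_eq_add_of_le' hn
  have hq := (qFun_neg hu).ne
  have hr := (rTwo_neg hu).ne
  -- Here `a = -r₁` and `b = -r₂`, written so that homogeneity extracts `(-r₂) ^ m`.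
  have h1 := succ_mul_weight_succ (u := u) (a := qFun u * -rTwo u) (b := 1 * -rTwo u)
    (by
      have := rOne_add_rTwo u
      rw [qFun]; field_simp; linarith)
    (by
      have := rOne_mul_rTwo hu
      rw [qFun]; field_simp; linarith) m
  rw [narayanaForm_mul, neg_pow] at h1
  have hm : (m : ℝ) + 1 ≠ 0 := by positivity
  rw [← coe_aeval_eq_eval, aeval_boNaPoly, eval_narayanaPoly, Nat.add_sub_cancel, mul_comm _ (qFun u),
    mul_div_mul_left _ _ hq, mul_assoc u, mul_assoc u, mul_div_assoc', ← h1]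
  push_cast
  rw [mul_div_cancel_left₀ _ hm]

theorem mainTheorem2 :
    (∀ n : ℕ, 0 < n → ∀ z : ℂ, aeval z (boNaPoly n) = 0 → ∃ x : ℝ, z = (x : ℂ)) ∧
    (∀ n : ℕ, 0 < n → ∀ u : ℝ, u < 0 →
      (boNaPoly n).eval u =
        u * (-1) ^ (n - 1) * rTwo u ^ (n - 1) * ((narayanaPoly n).eval (qFun u) / (n * qFun u))) ∧
    StrictMonoOn qFun (Set.Iio 0) ∧ Set.BijOn qFun (Set.Iio 0) (Set.Iio 0) :=
  ⟨fun _ hn _ hz => real_of_aeval_boNaPoly_eq_zero hn hz, fun _ hn _ hu => eval_boNaPoly hn hu,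
    qFun_strictMonoOn, qFun_bijOn⟩
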